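/- Let $n,m\ge 1$ and let $b_1,\dots,b_m$ be basis functions that are non-negative and not identically zero on $\{1,\dots,n\}$. Let $\mathcal L=\{\sum_{j=1}^m\alpha_jb_j:\alpha_j\ge 0\}$, and let $\mathcal G$ be the class of atomic congestion games with at most $n$ agents, finitely many resources and all resource costs $\ell_e\in\mathcal L$: agent $i$ chooses a set $a_i$ of resources from a non-empty family $\mathcal A_i$, and the system cost is $\mathrm{SC}(a)=\sum_i\sum_{e\in a_i}\ell_e(|a|_e)$, where $|a|_e$ is the number of agents using $e$. A local tolling mechanism $T$ maps each resource cost $\ell$ to a (real-valued) toll $T(\ell)$ depending on the congestion; under $T$, agent $i$ incurs $\sum_{e\in a_i}[\ell_e(|a|_e)+T(\ell_e)(|a|_e)]$. The price of anarchy is $\mathrm{PoA}(T)=\sup_{G\in\mathcal G}\mathrm{NECost}(G,T)/\mathrm{MinCost}(G)\in[0,\infty]$, where $\mathrm{NECost}(G,T)$ is the highest (expected) system cost at an equilibrium of the tolled game and $\mathrm{MinCost}(G)$ is the minimum of $\mathrm{SC}$; here $c/0=\infty$ for $c>0$, and instances with $\mathrm{NECost}=0$ are disregarded (they count as $0$).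 Let $\mathcal I$ be the set of $(x,y,z)\in\mathbb Z_{\ge 0}^3$ with $1\le x+y+z\le n$ and either $xyz=0$ or $x+y+z=n$. For each $j$ consider the linear program $$\max_{f\in\mathbb R^n,\ \rho\in\mathbb R}\ \rho\quad\text{s.t.}\quad b_j(x+z)(x+z)-\rho\, b_j(x+y)(x+y)+f(x+y)\,y-f(x+y+1)\,z\ \ge 0\quad\forall (x,y,z)\in\mathcal I,$$ with the convention $b_j(0)=f(0)=f(n+1)=0$. Each of these programs has an optimal solution. Let $(f^*_j,\rho^*_j)$ be any optimal solution of the $j$-th program, $j=1,\dots,m$. (i) The local mechanism $T^*(\ell)=\sum_{j=1}^m\alpha_j\tau^*_j$ for $\ell=\sum_{j=1}^m\alpha_jb_j$, $\alpha_j\ge0$, with $\tau^*_j(x)=f^*_j(x)-b_j(x)$ for $x\in\{1,\dots,n\}$, satisfies $\mathrm{PoA}(T^*)=\max_j 1/\rho^*_j$ (where $1/0=\infty$), and $\mathrm{PoA}(T^*)\le\mathrm{PoA}(T)$ for every local mechanism $T$, linear or not. (ii) If $\max_j 1/\rho^*_j<\infty$, then the mechanism $T(\ell)=\sum_{j=1}^m\alpha_j\tau_j$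 with $\tau_j(x)=f^*_j(x)\cdot\max_k(1/\rho^*_k)-b_j(x)$ has non-negative tolls on $\{1,\dots,n\}$, has the same price of anarchy $\max_j 1/\rho^*_j$, and is likewise optimal among all local mechanisms. (If the $b_j$ are linearly dependent, a cost $\ell$ may have several representations $\ell=\sum_j\alpha_jb_j$ with $\alpha_j\ge 0$; (i) and (ii) hold whichever one the mechanism uses for $\ell$.) All these statements hold when the price of anarchy is taken over pure Nash equilibria, and equally over mixed Nash, correlated, and coarse correlated equilibria. -/

import Mathlib

open scoped BigOperators ENNReal

noncomputable section

/-- An atomic congestion game: finitely many agents, a finite set of resources, for each agent a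
nonempty family of feasible subsets of the resources, and for each resource a cost as a function of
the number of agents using it (only the values at `1, …, numAgents` are ever used). -/
structure CongestionGame where
  numAgents : ℕ
  Resource : Type
  [fintypeResource : Fintype Resource]
  [decidableEqResource : DecidableEq Resource]
  actions : Fin numAgents → Finset (Finset Resource)
  actions_nonempty : ∀ i, (actions i).Nonempty
  cost : Resource → ℕ → ℝ

attribute [instance] CongestionGame.fintypeResource CongestionGame.decidableEqResource

/-- A local tolling mechanism: the toll `τ_e = T ℓ_e` on a resource (a function of the congestion
on it) is determined by the cost function `ℓ_e` of that resource alone. -/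
abbrev LocalMechanism : Type := (ℕ → ℝ) → (ℕ → ℝ)

/-- The equilibrium notions of the price of anarchy. -/
inductive EquilibriumConcept
  | pureNash
  | mixedNash
  | correlated
  | coarseCorrelated

namespace CongestionGame

/-- The feasible choices of agent `i`. -/
abbrev Action (G : CongestionGame) (i : Fin G.numAgents) : Type := {s // s ∈ G.actions i}

/-- Allocations `a = (a_1, …, a_k)`. -/
abbrev Alloc (G : CongestionGame) : Type := (i : Fin G.numAgents) → G.Action i

/-- `|a|_e`: the number of agents that use resource `e` in the allocation `a`. -/
def load (G : CongestionGame) (a : G.Alloc) (e : G.Resource) : ℕ :=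
  (Finset.univ.filter fun i => e ∈ (a i).1).card

/-- The system cost, which does not count the tolls. -/
def systemCost (G : CongestionGame) (a : G.Alloc) : ℝ :=
  ∑ i, ∑ e ∈ (a i).1, G.cost e (G.load a e)

/-- The cost incurred by agent `i` under the mechanism `T`: resource costs plus tolls. -/
def agentCost (G : CongestionGame) (T : LocalMechanism) (i : Fin G.numAgents)
    (a : G.Alloc) : ℝ :=
  ∑ e ∈ (a i).1, (G.cost e (G.load a e) + T (G.cost e) (G.load a e))

/-- Expectation under a probability distribution (vector of weights) on the allocations. -/
def expect (G : CongestionGame) (σ : G.Alloc → ℝ) (g : G.Alloc → ℝ) : ℝ :=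
  ∑ a, σ a * g a

/-- Pure Nash equilibria of the tolled game. -/
def IsPureNash (G : CongestionGame) (T : LocalMechanism) (a : G.Alloc) : Prop :=
  ∀ (i : Fin G.numAgents) (s : G.Action i),
    G.agentCost T i a ≤ G.agentCost T i (Function.update a i s)

/-- Coarse correlated equilibria: no agent gains in expectation by committing, before the draw,
to a fixed action. -/
def IsCoarseCorrelated (G : CongestionGame) (T : LocalMechanism) (σ : G.Alloc → ℝ) : Prop :=
  σ ∈ stdSimplex ℝ G.Alloc ∧
    ∀ (i : Fin G.numAgents) (s : G.Action i),
      G.expect σ (G.agentCost T i) ≤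
        G.expect σ fun a => G.agentCost T i (Function.update a i s)

/-- Correlated equilibria: no agent gains in expectation by applying a swap map to the action
that is recommended to her. -/
def IsCorrelated (G : CongestionGame) (T : LocalMechanism) (σ : G.Alloc → ℝ) : Prop :=
  σ ∈ stdSimplex ℝ G.Alloc ∧
    ∀ (i : Fin G.numAgents) (φ : G.Action i → G.Action i),
      G.expect σ (G.agentCost T i) ≤
        G.expect σ fun a => G.agentCost T i (Function.update a i (φ (a i)))

/-- Mixed Nash equilibria: the agents randomize independently, and no agent gains in expectation
by deviating to a fixed action (equivalently, to a mixed one). -/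
def IsMixedNash (G : CongestionGame) (T : LocalMechanism) (σ : G.Alloc → ℝ) : Prop :=
  (∃ p : (i : Fin G.numAgents) → G.Action i → ℝ,
      (∀ i, p i ∈ stdSimplex ℝ (G.Action i)) ∧ ∀ a, σ a = ∏ i, p i (a i)) ∧
    ∀ (i : Fin G.numAgents) (s : G.Action i),
      G.expect σ (G.agentCost T i) ≤
        G.expect σ fun a => G.agentCost T i (Function.update a i s)

/-- `NECost(G, T)`: the highest (expected) system cost at an equilibrium of the given kind. -/
def worstCost (G : CongestionGame) (T : LocalMechanism) : EquilibriumConcept → ℝ≥0∞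
  | .pureNash => ⨆ (a : G.Alloc) (_ : G.IsPureNash T a), ENNReal.ofReal (G.systemCost a)
  | .mixedNash =>
      ⨆ (σ : G.Alloc → ℝ) (_ : G.IsMixedNash T σ), ENNReal.ofReal (G.expect σ G.systemCost)
  | .correlated =>
      ⨆ (σ : G.Alloc → ℝ) (_ : G.IsCorrelated T σ), ENNReal.ofReal (G.expect σ G.systemCost)
  | .coarseCorrelated =>
      ⨆ (σ : G.Alloc → ℝ) (_ : G.IsCoarseCorrelated T σ),
        ENNReal.ofReal (G.expect σ G.systemCost)

/-- `MinCost(G)`: the minimum system cost. -/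
def minCost (G : CongestionGame) : ℝ≥0∞ :=
  ⨅ a : G.Alloc, ENNReal.ofReal (G.systemCost a)

end CongestionGame

/-- `ℓ = ∑ j, α_j b_j` with coefficients `α_j ≥ 0`. -/
def IsNonnegComb {m : ℕ} (b : Fin m → ℕ → ℝ) (α : Fin m → ℝ) (ℓ : ℕ → ℝ) : Prop :=
  (∀ j, 0 ≤ α j) ∧ ∀ x, ℓ x = ∑ j, α j * b j x

/-- The resource costs generated by the basis functions `b_1, …, b_m`. -/
def costClass {m : ℕ} (b : Fin m → ℕ → ℝ) : Set (ℕ → ℝ) :=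
  {ℓ | ∃ α, IsNonnegComb b α ℓ}

/-- The congestion games with at most `n` agents and all resource costs generated by `b`. -/
def gameClass (n : ℕ) {m : ℕ} (b : Fin m → ℕ → ℝ) : Set CongestionGame :=
  {G | G.numAgents ≤ n ∧ ∀ e, G.cost e ∈ costClass b}

/-- The price of anarchy of a local mechanism, for a given equilibrium notion, as an extended
nonnegative real: `c / 0 = ∞` for `c > 0`, while the meaningless instances, in which every
equilibrium costs `0`, contribute `0` to the supremum (also when `MinCost = 0`). -/
def priceOfAnarchy (n : ℕ) {m : ℕ} (b : Fin m → ℕ → ℝ) (c : EquilibriumConcept)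
    (T : LocalMechanism) : ℝ≥0∞ :=
  ⨆ (G : CongestionGame) (_ : G ∈ gameClass n b), G.worstCost T c / G.minCost

/-- `T(∑ j, α_j b_j) = ∑ j, α_j τ_j` on the congestion levels `1, …, n`. If the `b_j` are linearly
independent, the coefficients of each cost are unique and this determines the tolls; otherwise,
since a local mechanism only sees the function `ℓ`, it may use any one representation of `ℓ`. -/
def IsLinearMechanism (n : ℕ) {m : ℕ} (b τ : Fin m → ℕ → ℝ) (T : LocalMechanism) : Prop :=
  ∀ ℓ ∈ costClass b, ∃ α, IsNonnegComb b α ℓ ∧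
    ∀ x ∈ Finset.Icc 1 n, T ℓ x = ∑ j, α j * τ j x

/-- The index set of the constraints of the linear program. -/
def tripleSet (n : ℕ) : Set (ℕ × ℕ × ℕ) :=
  {t | 1 ≤ t.1 + t.2.1 + t.2.2 ∧ t.1 + t.2.1 + t.2.2 ≤ n ∧
    (t.1 * t.2.1 * t.2.2 = 0 ∨ t.1 + t.2.1 + t.2.2 = n)}

/-- Feasibility of `(f, ρ)`. Only `b 1, …, b n` and `f 1, …, f n` matter: on the index set the
terms `b 0`, `f 0` and `f (n + 1)` only occur with the factor `0`, so that the convention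
`b 0 = f 0 = f (n + 1) = 0` holds in effect. -/
def LPFeasible (n : ℕ) (b f : ℕ → ℝ) (ρ : ℝ) : Prop :=
  ∀ x y z : ℕ, (x, y, z) ∈ tripleSet n →
    0 ≤ b (x + z) * ((x + z : ℕ) : ℝ) - ρ * b (x + y) * ((x + y : ℕ) : ℝ)
        + f (x + y) * (y : ℝ) - f (x + y + 1) * (z : ℝ)

/-- `(f, ρ)` solves the linear program: it is feasible and its `ρ` is maximal. -/
def IsLPSolution (n : ℕ) (b f : ℕ → ℝ) (ρ : ℝ) : Prop :=
  LPFeasible n b f ρ ∧ ∀ (f' : ℕ → ℝ) (ρ' : ℝ), LPFeasible n b f' ρ' → ρ' ≤ ρ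

end

/-! The price of anarchy is squeezed between a smoothness bound for coarse correlated equilibria and
a family of games with bad pure equilibria. Upper bound: compare allocations `a` and `o` on one
resource, with `x` agents using it in both, `y` only in `a` and `z` only in `o`. If `f` is a
multiple `ν ≥ 0` of cost plus toll, the constraint at `(x, y, z)` bounds `ν` times the total change
of the agents' costs under the deviations `a_i → o_i`. Constraints for different `b_j` add up with
weights `α_j ≥ 0` once they share one `ρ`, namely the smallest `ρ_j`. Averaged over an equilibrium
this gives `ρ E[SC] ≤ SC(o)`. Lower bound: let `ρ` exceed the optimal value of program `j`. For any
mechanism `T`, no multiple of `b_j + T(b_j)` is feasible, so Farkas' lemma in the single unknown `ν`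
yields two triples with integer multiplicities (`exists_nat_combination`). Circles of resources of
cost `b_j`, in these multiplicities, form a game whose equilibrium costs more than `1/ρ` times
another allocation. Only the toll on `b_j` enters, so linearity of `T` is irrelevant. Rescaling
agent costs changes only `ν`, whence the version with nonnegative tolls. -/

open Finset

/-! ### The linear program: extra constraints, bounds on `f` and `ρ`, existence of optima -/

section LinearProgram

variable {n : ℕ} {b f : ℕ → ℝ} {ρ : ℝ}

/-- For fixed `x + y` and `x + z` the constraints are affine in `x`, so that those of the index set
imply the constraints at all triples of sum at most `n`. -/
lemma LPFeasible.nonneg_of_sum_le (h : LPFeasible n b f ρ) {x y z : ℕ} (hn : x + y + z ≤ n) :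
    0 ≤ b (x + z) * ((x + z : ℕ) : ℝ) - ρ * b (x + y) * ((x + y : ℕ) : ℝ)
        + f (x + y) * (y : ℝ) - f (x + y + 1) * (z : ℝ) := by
  rcases Nat.eq_zero_or_pos (x + y + z) with h0 | h0
  · obtain ⟨rfl, rfl, rfl⟩ : x = 0 ∧ y = 0 ∧ z = 0 := by omega
    simp
  by_cases hI : x * y * z = 0 ∨ x + y + z = n
  · exact h x y z ⟨h0, hn, hI⟩
  obtain ⟨hxyz, hsum⟩ := not_or.mp hI
  simp only [mul_eq_zero, not_or] at hxyz
  obtain ⟨⟨hx, hy⟩, hz⟩ := hxyz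
  -- Trading `d` units of `x` for `d` units of both `y` and `z` changes the expression by `d * (f (x
  -- + y) - f (x + y + 1))`. The trade is made in the direction that does not increase it, until the
  -- index set is reached.
  rcases le_total (f (x + y)) (f (x + y + 1)) with hf | hf
  · obtain ⟨d, hd⟩ : ∃ d, d = min x (n - (x + y + z)) := ⟨_, rfl⟩
    obtain ⟨x', rfl⟩ : ∃ x', x = x' + d := ⟨x - d, by omega⟩
    have key := h x' (y + d) (z + d) ⟨by dsimp; omega, by dsimp; omega, by
      rcases Nat.eq_zero_or_pos x' with rfl | hx'
      · simp
      · right; dsimp; omega⟩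
    rw [show x' + (z + d) = x' + d + z by ring, show x' + (y + d) = x' + d + y by ring] at key
    have hd0 : (0 : ℝ) ≤ d := d.cast_nonneg
    push_cast at key ⊢
    nlinarith
  · obtain ⟨d, hd⟩ : ∃ d, d = min y z := ⟨_, rfl⟩
    obtain ⟨y', rfl⟩ : ∃ y', y = y' + d := ⟨y - d, by omega⟩
    obtain ⟨z', rfl⟩ : ∃ z', z = z' + d := ⟨z - d, by omega⟩
    have key := h (x + d) y' z' ⟨by dsimp; omega, by dsimp; omega, by
      left
      have : y' = 0 ∨ z' = 0 := by omega
      rcases this with rfl | rfl <;> simp⟩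
    rw [show x + d + z' = x + (z' + d) by ring, show x + d + y' = x + (y' + d) by ring] at key
    have hd0 : (0 : ℝ) ≤ d := d.cast_nonneg
    push_cast at key ⊢
    nlinarith

lemma LPFeasible.mono {ρ' : ℝ} (hb : ∀ x ∈ Icc 1 n, 0 ≤ b x) (h : LPFeasible n b f ρ)
    (hρ : ρ' ≤ ρ) : LPFeasible n b f ρ' := by
  intro x y z ht
  have key := h x y z ht
  have hle : x + y + z ≤ n := ht.2.1
  have : 0 ≤ b (x + y) * ((x + y : ℕ) : ℝ) := by
    rcases Nat.eq_zero_or_pos (x + y) with h0 | h0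
    · simp [h0]
    · exact mul_nonneg (hb _ (mem_Icc.2 ⟨h0, by omega⟩)) (Nat.cast_nonneg _)
  nlinarith

lemma lpFeasible_zero (hb : ∀ x ∈ Icc 1 n, 0 ≤ b x) : LPFeasible n b 0 0 := by
  intro x y z ht
  have hle : x + y + z ≤ n := ht.2.1
  have : 0 ≤ b (x + z) * ((x + z : ℕ) : ℝ) := by
    rcases Nat.eq_zero_or_pos (x + z) with h0 | h0
    · simp [h0]
    · exact mul_nonneg (hb _ (mem_Icc.2 ⟨h0, by omega⟩)) (Nat.cast_nonneg _)
  simpa using this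

/-- This is the constraint at `(0, x, 0)`. It serves both compactness and the sign of the rescaled
tolls. -/
lemma LPFeasible.mul_le (h : LPFeasible n b f ρ) {x : ℕ} (hx : x ∈ Icc 1 n) : ρ * b x ≤ f x := by
  obtain ⟨h1, h2⟩ := mem_Icc.1 hx
  have key := h 0 x 0 ⟨by dsimp; omega, by dsimp; omega, by simp⟩
  have hx0 : (0 : ℝ) < x := by exact_mod_cast h1
  simp only [Nat.zero_add, Nat.cast_zero, mul_zero, zero_sub, sub_zero] at key
  exact le_of_mul_le_mul_right (by linarith) hx0

lemma LPFeasible.le_mul (h : LPFeasible n b f ρ) (hb : ∀ x ∈ Icc 1 n, 0 ≤ b x) (hρ : 0 ≤ ρ)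
    {x : ℕ} (hx : x ∈ Icc 1 n) : f x ≤ b x * x := by
  obtain ⟨h1, h2⟩ := mem_Icc.1 hx
  obtain ⟨k, rfl⟩ : ∃ k, x = k + 1 := ⟨x - 1, by omega⟩
  -- Lowering `ρ` to `0` first removes the term in `b k`.
  have key := (h.mono hb hρ) k 0 1 ⟨by dsimp; omega, by dsimp; omega, by simp⟩
  simp at key
  push_cast
  linarith

lemma LPFeasible.le_one (h : LPFeasible n b f ρ) (hb : ∀ x ∈ Icc 1 n, 0 ≤ b x)
    (hb0 : ∃ x ∈ Icc 1 n, b x ≠ 0) : ρ ≤ 1 := by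
  obtain ⟨x, hx, hne⟩ := hb0
  obtain ⟨h1, h2⟩ := mem_Icc.1 hx
  have key := h x 0 0 ⟨by dsimp; omega, by dsimp; omega, by simp⟩
  have hx0 : (0 : ℝ) < x := by exact_mod_cast h1
  have hpos : 0 < b x * x := mul_pos (lt_of_le_of_ne (hb x hx) hne.symm) hx0
  simp at key
  by_contra hlt
  nlinarith

lemma LPFeasible.congr {f' : ℕ → ℝ} (h : LPFeasible n b f ρ) (hf : ∀ x ∈ Icc 1 n, f' x = f x) :
    LPFeasible n b f' ρ := by
  intro x y z ht
  have key := h x y z ht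
  have hle : x + y + z ≤ n := ht.2.1
  have e1 : f' (x + y) * (y : ℝ) = f (x + y) * y := by
    rcases Nat.eq_zero_or_pos y with rfl | h0
    · simp
    · rw [hf _ (mem_Icc.2 ⟨by omega, by omega⟩)]
  have e2 : f' (x + y + 1) * (z : ℝ) = f (x + y + 1) * z := by
    rcases Nat.eq_zero_or_pos z with rfl | h0
    · simp
    · rw [hf _ (mem_Icc.2 ⟨by omega, by omega⟩)]
  rw [e1, e2]
  exact key

lemma isClosed_lpFeasible (n : ℕ) (b : ℕ → ℝ) :
    IsClosed {p : (ℕ → ℝ) × ℝ | LPFeasible n b p.1 p.2} := by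
  simp only [LPFeasible, Set.ofPred_forall]
  refine isClosed_iInter fun x => isClosed_iInter fun y => isClosed_iInter fun z =>
    isClosed_iInter fun _ => isClosed_le continuous_const ?_
  fun_prop

/-- For `ρ ≥ 0` the constraints confine `ρ` to `[0, 1]` and each `f k`, `1 ≤ k ≤ n`, to `[0, b k *
k]`. The other values of `f` are immaterial and are set to `0`, which makes the search space a
compact product. -/
lemma exists_isLPSolution (hb : ∀ x ∈ Icc 1 n, 0 ≤ b x) (hb0 : ∃ x ∈ Icc 1 n, b x ≠ 0) :
    ∃ f ρ, IsLPSolution n b f ρ := by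
  have hcompact : IsCompact (((Set.univ.pi fun k : ℕ =>
      Set.Icc (0 : ℝ) (if k ∈ Icc 1 n then b k * k else 0)) ×ˢ Set.Icc (0 : ℝ) 1) ∩
      {p : (ℕ → ℝ) × ℝ | LPFeasible n b p.1 p.2}) :=
    ((isCompact_univ_pi fun _ => isCompact_Icc).prod isCompact_Icc).inter_right
      (isClosed_lpFeasible n b)
  have hmem : ∀ f ρ, 0 ≤ ρ → LPFeasible n b f ρ →
      ((fun k => if k ∈ Icc 1 n then f k else 0), ρ) ∈ (((Set.univ.pi fun k : ℕ =>
      Set.Icc (0 : ℝ) (if k ∈ Icc 1 n then b k * k else 0)) ×ˢ Set.Icc (0 : ℝ) 1) ∩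
      {p : (ℕ → ℝ) × ℝ | LPFeasible n b p.1 p.2}) := by
    intro f ρ hρ h
    refine ⟨⟨fun k _ => ?_, hρ, h.le_one hb hb0⟩, h.congr fun x hx => if_pos hx⟩
    by_cases hk : k ∈ Icc 1 n
    · simp only [if_pos hk]
      exact ⟨(mul_nonneg hρ (hb k hk)).trans (h.mul_le hk), h.le_mul hb hρ hk⟩
    · simp only [if_neg hk, Set.left_mem_Icc, le_refl]
  obtain ⟨⟨f, ρ⟩, hfρ, hmax⟩ := hcompact.exists_isMaxOn
    ⟨_, hmem 0 0 le_rfl (lpFeasible_zero hb)⟩ continuous_snd.continuousOn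
  refine ⟨f, ρ, hfρ.2, fun f' ρ' h' => ?_⟩
  rcases le_total 0 ρ' with h0 | h0
  · exact hmax (hmem f' ρ' h0 h')
  · exact h0.trans hfρ.1.2.1

lemma IsLPSolution.nonneg (hb : ∀ x ∈ Icc 1 n, 0 ≤ b x) (h : IsLPSolution n b f ρ) : 0 ≤ ρ :=
  h.2 _ _ (lpFeasible_zero hb)

end LinearProgram

/-! ### Farkas' lemma in one variable -/

/-- A one-variable Farkas lemma with integer multipliers: if no `ν ≥ 0` satisfies
`0 ≤ A t + ν * C t` for all `t ∈ S`, this is witnessed by two of the constraints. -/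
lemma exists_nat_combination {ι : Type*} (S : Finset ι) (A C : ι → ℝ)
    (h : ∀ ν : ℝ, 0 ≤ ν → ∃ t ∈ S, A t + ν * C t < 0) :
    ∃ s ∈ S, ∃ t ∈ S, ∃ p q : ℕ,
      (p : ℝ) * C s + q * C t ≤ 0 ∧ (p : ℝ) * A s + q * A t < 0 := by
  classical
  by_cases hneg : ∃ t ∈ S, A t < 0 ∧ C t ≤ 0
  · obtain ⟨t, ht, hA, hC⟩ := hneg
    exact ⟨t, ht, t, ht, 1, 0, by simpa using hC, by simpa using hA⟩
  push Not at hneg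
  obtain ⟨t₀, ht₀, hA₀⟩ := h 0 le_rfl
  rw [zero_mul, add_zero] at hA₀
  have hne : (S.filter fun t => 0 < C t).Nonempty :=
    ⟨t₀, mem_filter.2 ⟨ht₀, hneg t₀ ht₀ hA₀⟩⟩
  -- Among the constraints with `C > 0`, `t` gives the strongest lower bound on `ν`. At that value
  -- of `ν` the violated constraint `s` must be an upper bound.
  obtain ⟨t, ht, hmax⟩ := exists_max_image _ (fun t => -A t / C t) hne
  obtain ⟨htS, hCt⟩ := mem_filter.1 ht
  have hpos : 0 < -A t / C t :=
    (div_pos (neg_pos.2 hA₀) (hneg t₀ ht₀ hA₀)).trans_le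
      (hmax t₀ (mem_filter.2 ⟨ht₀, hneg t₀ ht₀ hA₀⟩))
  have hAt : 0 < -A t := by
    by_contra hle
    exact absurd hpos (not_lt.2 (div_nonpos_of_nonpos_of_nonneg (not_lt.1 hle) hCt.le))
  obtain ⟨s, hs, hlt⟩ := h _ hpos.le
  have hCs : C s ≤ 0 := by
    by_contra hlt'
    have hCs := not_le.1 hlt'
    have := hmax s (mem_filter.2 ⟨hs, hCs⟩)
    rw [div_le_iff₀ hCs] at this
    linarith
  have hAs : 0 ≤ A s := by
    by_contra hlt'
    exact absurd (hneg s hs (not_le.1 hlt')) (not_lt.2 hCs)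
  have hbtw : A s / -A t < -C s / C t := by
    rw [div_lt_div_iff₀ hAt hCt]
    have hlt' : -A t * C s / C t < -A s := by
      rw [← div_mul_eq_mul_div]
      linarith
    rw [div_lt_iff₀ hCt] at hlt'
    linarith
  -- Any `p / q` strictly between the two ratios gives valid multipliers; `A s ≥ 0` makes it
  -- positive, so `p` is a natural number.
  obtain ⟨r, hr1, hr2⟩ := exists_rat_btwn hbtw
  have hr0 : 0 < r := by exact_mod_cast (div_nonneg hAs hAt.le).trans_lt hr1
  have hden : (0 : ℝ) < r.den := by exact_mod_cast r.den_pos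
  have hr : (r : ℝ) = r.num.toNat / r.den := by
    have : ((r.num.toNat : ℤ) : ℝ) = r.num := by
      rw [Int.toNat_of_nonneg (Rat.num_nonneg.2 hr0.le)]
    rw [Rat.cast_def, ← this, Int.cast_natCast]
  rw [hr, div_lt_div_iff₀ hAt hden] at hr1
  rw [hr, div_lt_div_iff₀ hden hCt] at hr2
  exact ⟨t, htS, s, hs, r.num.toNat, r.den, by linarith, by linarith⟩

/-! ### Load decomposition, smoothness and equilibrium notions -/

namespace CongestionGame

variable (G : CongestionGame)

lemma sum_sum_mem (a : G.Alloc) (h : G.Resource → ℝ) :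
    ∑ i, ∑ e ∈ (a i).1, h e = ∑ e, (G.load a e : ℝ) * h e := by
  simp_rw [load, card_filter, Nat.cast_sum, sum_mul]
  rw [sum_comm]
  refine sum_congr rfl fun i _ => ?_
  simp [ite_mul, sum_ite_mem]

lemma systemCost_eq (a : G.Alloc) :
    G.systemCost a = ∑ e, (G.load a e : ℝ) * G.cost e (G.load a e) :=
  G.sum_sum_mem a _

/-- The load on the new resources of an agent that deviates to `s`. -/
lemma load_update {a : G.Alloc} {i : Fin G.numAgents} {s : G.Action i} {e : G.Resource}
    (he : e ∈ s.1) :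
    G.load (Function.update a i s) e = if e ∈ (a i).1 then G.load a e else G.load a e + 1 := by
  classical
  have hrest : ∀ c : G.Alloc, G.load c e =
      (if e ∈ (c i).1 then 1 else 0) + ∑ k ∈ univ.erase i, if e ∈ (c k).1 then 1 else 0 := by
    intro c
    rw [load, card_filter, ← add_sum_erase _ _ (mem_univ i)]
  have hsame : ∑ k ∈ univ.erase i, (if e ∈ (Function.update a i s k).1 then 1 else 0) =
      ∑ k ∈ univ.erase i, if e ∈ (a k).1 then 1 else 0 :=
    sum_congr rfl fun k hk => by rw [Function.update_of_ne (ne_of_mem_erase hk)]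
  rw [hrest (Function.update a i s), hsame, hrest a, Function.update_self, if_pos he]
  split_ifs <;> omega

/-- The number of agents that use `e` in both allocations. -/
def commonLoad (a o : G.Alloc) (e : G.Resource) : ℕ :=
  (univ.filter fun i => e ∈ (a i).1 ∧ e ∈ (o i).1).card

/-- The number of agents that use `e` in `a` but not in `o`. -/
def excessLoad (a o : G.Alloc) (e : G.Resource) : ℕ :=
  (univ.filter fun i => e ∈ (a i).1 ∧ e ∉ (o i).1).card

lemma commonLoad_add_excessLoad (a o : G.Alloc) (e : G.Resource) :
    G.commonLoad a o e + G.excessLoad a o e = G.load a e := by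
  rw [commonLoad, excessLoad, load, ← filter_filter, ← filter_filter,
    card_filter_add_card_filter_not]

lemma commonLoad_comm (a o : G.Alloc) (e : G.Resource) :
    G.commonLoad a o e = G.commonLoad o a e := by
  simp only [commonLoad, and_comm]

lemma commonLoad_add_excessLoad_add_excessLoad_le (a o : G.Alloc) (e : G.Resource) :
    G.commonLoad a o e + G.excessLoad a o e + G.excessLoad o a e ≤ G.numAgents := by
  rw [commonLoad_add_excessLoad, load, excessLoad, ← card_union_of_disjoint]
  · exact (card_le_univ _).trans_eq (by simp)
  · rw [disjoint_filter]
    tauto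

/-- An agent moving to `o i` meets the old load where it already was and one more elsewhere; the
agents of each sort are then counted resource by resource. -/
lemma sum_sum_update (a o : G.Alloc) (h : G.Resource → ℕ → ℝ) :
    ∑ i, ∑ e ∈ (o i).1, h e (G.load (Function.update a i (o i)) e) =
      ∑ e, ((G.commonLoad a o e : ℝ) * h e (G.load a e) +
        G.excessLoad o a e * h e (G.load a e + 1)) := by
  have hi : ∀ i, ∑ e ∈ (o i).1, h e (G.load (Function.update a i (o i)) e) =
      ∑ e, ((if e ∈ (a i).1 ∧ e ∈ (o i).1 then (1 : ℝ) else 0) * h e (G.load a e) +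
        (if e ∈ (o i).1 ∧ e ∉ (a i).1 then 1 else 0) * h e (G.load a e + 1)) := by
    intro i
    rw [← sum_subset (subset_univ (o i).1)]
    · refine sum_congr rfl fun e he => ?_
      rw [G.load_update he]
      by_cases hea : e ∈ (a i).1 <;> simp [he, hea]
    · intro e _ he
      simp [he]
  simp_rw [hi]
  rw [sum_comm]
  refine sum_congr rfl fun e _ => ?_
  rw [sum_add_distrib, ← sum_mul, ← sum_mul, commonLoad, excessLoad, card_filter, card_filter]
  push_cast
  rfl

/-- The smoothness inequality, resource by resource. -/
lemma systemCost_sub_le_of_lpFeasible {n m : ℕ} {b τ : Fin m → ℕ → ℝ} {T : LocalMechanism}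
    {ν ρ : ℝ} {G : CongestionGame} (hG : G ∈ gameClass n b)
    (hf : ∀ j, LPFeasible n (b j) (fun x => ν * (b j x + τ j x)) ρ)
    (hT : IsLinearMechanism n b τ T) (a o : G.Alloc) :
    ν * ∑ i, (G.agentCost T i (Function.update a i (o i)) - G.agentCost T i a) ≤
      G.systemCost o - ρ * G.systemCost a := by
  obtain ⟨hn, hcost⟩ := hG
  set F : G.Resource → ℕ → ℝ := fun e k => G.cost e k + T (G.cost e) k with hF
  have hsum := G.sum_sum_update a o F
  have hsum' := G.sum_sum_mem a fun e => F e (G.load a e)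
  simp only [agentCost, sum_sub_distrib, Function.update_self]
  rw [show ∑ i, ∑ e ∈ (o i).1, (G.cost e (G.load (Function.update a i (o i)) e) +
      T (G.cost e) (G.load (Function.update a i (o i)) e)) = _ from hsum,
    show ∑ i, ∑ e ∈ (a i).1, (G.cost e (G.load a e) + T (G.cost e) (G.load a e)) = _ from hsum',
    systemCost_eq, systemCost_eq, ← sum_sub_distrib, mul_sum, mul_sum, ← sum_sub_distrib]
  refine sum_le_sum fun e _ => ?_
  obtain ⟨α, ⟨hα, hℓ⟩, hTα⟩ := hT _ (hcost e)
  have hxy := G.commonLoad_add_excessLoad a o e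
  have hxz := G.commonLoad_add_excessLoad o a e
  have hle := (G.commonLoad_add_excessLoad_add_excessLoad_le a o e).trans hn
  rw [← G.commonLoad_comm a o] at hxz
  rw [← hxy, ← hxz]
  generalize G.commonLoad a o e = x at *
  generalize G.excessLoad a o e = y at *
  generalize G.excessLoad o a e = z at *
  have hFα : ∀ k ∈ Icc 1 n, F e k = ∑ j, α j * (b j k + τ j k) := by
    intro k hk
    simp only [hF, hℓ k, hTα k hk, mul_add, sum_add_distrib]
  -- The tolls are prescribed on `1, …, n` only; the arguments `0` and `n + 1` occur with factor
  -- `0`.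
  have hy : F e (x + y) * (y : ℝ) = (∑ j, α j * (b j (x + y) + τ j (x + y))) * y := by
    rcases Nat.eq_zero_or_pos y with rfl | h0
    · simp
    · rw [hFα _ (mem_Icc.2 ⟨by omega, by omega⟩)]
  have hz : F e (x + y + 1) * (z : ℝ) =
      (∑ j, α j * (b j (x + y + 1) + τ j (x + y + 1))) * z := by
    rcases Nat.eq_zero_or_pos z with rfl | h0
    · simp
    · rw [hFα _ (mem_Icc.2 ⟨by omega, by omega⟩)]
  have key : 0 ≤ ∑ j, α j * (b j (x + z) * ((x + z : ℕ) : ℝ)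
      - ρ * b j (x + y) * ((x + y : ℕ) : ℝ) + ν * (b j (x + y) + τ j (x + y)) * (y : ℝ)
      - ν * (b j (x + y + 1) + τ j (x + y + 1)) * (z : ℝ)) :=
    sum_nonneg fun j _ => mul_nonneg (hα j) ((hf j).nonneg_of_sum_le hle)
  have hexp : ∑ j, α j * (b j (x + z) * ((x + z : ℕ) : ℝ)
      - ρ * b j (x + y) * ((x + y : ℕ) : ℝ) + ν * (b j (x + y) + τ j (x + y)) * (y : ℝ)
      - ν * (b j (x + y + 1) + τ j (x + y + 1)) * (z : ℝ)) =
      (∑ j, α j * b j (x + z)) * ((x + z : ℕ) : ℝ)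
      - ρ * ((∑ j, α j * b j (x + y)) * ((x + y : ℕ) : ℝ))
      + ν * ((∑ j, α j * (b j (x + y) + τ j (x + y))) * (y : ℝ))
      - ν * ((∑ j, α j * (b j (x + y + 1) + τ j (x + y + 1))) * (z : ℝ)) := by
    simp only [sum_mul, mul_sum, ← sum_sub_distrib, ← sum_add_distrib]
    exact sum_congr rfl fun j _ => by ring
  rw [hexp, ← hy, ← hz, ← hℓ, ← hℓ] at key
  push_cast at key ⊢
  linarith

section Equilibria

variable {G} {T : LocalMechanism}

lemma expect_single [DecidableEq G.Alloc] (a : G.Alloc) (g : G.Alloc → ℝ) :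
    G.expect (Pi.single a 1) g = g a := by
  simp [expect, Pi.single_apply]

lemma IsPureNash.isMixedNash [DecidableEq G.Alloc] {a : G.Alloc} (h : G.IsPureNash T a) :
    G.IsMixedNash T (Pi.single a 1) := by
  refine ⟨⟨fun i => Pi.single (a i) 1, fun i => single_mem_stdSimplex ℝ (a i), fun c => ?_⟩,
    fun i s => ?_⟩
  · by_cases hc : c = a
    · simp [hc]
    · obtain ⟨i, hi⟩ := Function.ne_iff.1 hc
      rw [Pi.single_eq_of_ne hc]
      exact (prod_eq_zero (mem_univ i) (Pi.single_eq_of_ne hi 1)).symm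
  · simpa only [expect_single] using h i s

lemma IsPureNash.isCorrelated [DecidableEq G.Alloc] {a : G.Alloc} (h : G.IsPureNash T a) :
    G.IsCorrelated T (Pi.single a 1) := by
  refine ⟨single_mem_stdSimplex ℝ a, fun i φ => ?_⟩
  simpa only [expect_single] using h i (φ (a i))

lemma IsCorrelated.isCoarseCorrelated {σ : G.Alloc → ℝ} (h : G.IsCorrelated T σ) :
    G.IsCoarseCorrelated T σ :=
  ⟨h.1, fun i s => h.2 i fun _ => s⟩

lemma IsMixedNash.isCoarseCorrelated {σ : G.Alloc → ℝ} (h : G.IsMixedNash T σ) :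
    G.IsCoarseCorrelated T σ := by
  obtain ⟨⟨p, hp, hσ⟩, hdev⟩ := h
  refine ⟨⟨fun a => ?_, ?_⟩, hdev⟩
  · rw [hσ]
    exact prod_nonneg fun i _ => (hp i).1 _
  · simp_rw [hσ]
    rw [← Fintype.prod_sum]
    exact prod_eq_one fun i _ => (hp i).2

/-- Coarse correlated equilibria include all other kinds, pure ones as point masses, so upper bounds
are needed for them alone. -/
lemma worstCost_le_coarseCorrelated (c : EquilibriumConcept) :
    G.worstCost T c ≤ G.worstCost T .coarseCorrelated := by
  classical
  have hle : ∀ σ, G.IsCoarseCorrelated T σ →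
      ENNReal.ofReal (G.expect σ G.systemCost) ≤ G.worstCost T .coarseCorrelated :=
    fun σ hσ => le_iSup₂ (f := fun (σ : G.Alloc → ℝ) (_ : G.IsCoarseCorrelated T σ) =>
      ENNReal.ofReal (G.expect σ G.systemCost)) σ hσ
  cases c with
  | pureNash =>
    refine iSup₂_le fun a ha => ?_
    rw [← expect_single a G.systemCost]
    exact hle _ ha.isCorrelated.isCoarseCorrelated
  | mixedNash => exact iSup₂_le fun σ hσ => hle σ hσ.isCoarseCorrelated
  | correlated => exact iSup₂_le fun σ hσ => hle σ hσ.isCoarseCorrelated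
  | coarseCorrelated => exact le_rfl

/-- Conversely, a bad pure equilibrium gives a lower bound for every kind. -/
lemma IsPureNash.le_worstCost {a : G.Alloc} (h : G.IsPureNash T a) (c : EquilibriumConcept) :
    ENNReal.ofReal (G.systemCost a) ≤ G.worstCost T c := by
  classical
  cases c with
  | pureNash =>
    exact le_iSup₂ (f := fun (a : G.Alloc) (_ : G.IsPureNash T a) =>
      ENNReal.ofReal (G.systemCost a)) a h
  | mixedNash =>
    rw [← expect_single a G.systemCost]
    exact le_iSup₂ (f := fun (σ : G.Alloc → ℝ) (_ : G.IsMixedNash T σ) =>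
      ENNReal.ofReal (G.expect σ G.systemCost)) _ h.isMixedNash
  | correlated =>
    rw [← expect_single a G.systemCost]
    exact le_iSup₂ (f := fun (σ : G.Alloc → ℝ) (_ : G.IsCorrelated T σ) =>
      ENNReal.ofReal (G.expect σ G.systemCost)) _ h.isCorrelated
  | coarseCorrelated =>
    rw [← expect_single a G.systemCost]
    exact le_iSup₂ (f := fun (σ : G.Alloc → ℝ) (_ : G.IsCoarseCorrelated T σ) =>
      ENNReal.ofReal (G.expect σ G.systemCost)) _ h.isCorrelated.isCoarseCorrelated

end Equilibria

/-- The deviations `o i` do not depend on the draw, so the equilibrium condition makes the averaged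
left side of the smoothness inequality nonnegative. -/
lemma IsCoarseCorrelated.mul_expect_systemCost_le {n m : ℕ} {b τ : Fin m → ℕ → ℝ}
    {T : LocalMechanism} {ν ρ : ℝ} {G : CongestionGame} (hG : G ∈ gameClass n b) (hν : 0 ≤ ν)
    (hf : ∀ j, LPFeasible n (b j) (fun x => ν * (b j x + τ j x)) ρ)
    (hT : IsLinearMechanism n b τ T) {σ : G.Alloc → ℝ} (hσ : G.IsCoarseCorrelated T σ)
    (o : G.Alloc) : ρ * G.expect σ G.systemCost ≤ G.systemCost o := by
  have hdev : 0 ≤ ∑ i, ∑ a, σ a *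
      (G.agentCost T i (Function.update a i (o i)) - G.agentCost T i a) := by
    refine sum_nonneg fun i _ => ?_
    have := hσ.2 i (o i)
    simp only [expect] at this
    simp only [mul_sub, sum_sub_distrib]
    linarith
  have hsmooth : ∑ a, σ a * (ν * ∑ i,
      (G.agentCost T i (Function.update a i (o i)) - G.agentCost T i a)) ≤
      ∑ a, σ a * (G.systemCost o - ρ * G.systemCost a) :=
    sum_le_sum fun a _ => mul_le_mul_of_nonneg_left
      (systemCost_sub_le_of_lpFeasible hG hf hT a o) (hσ.1.1 a)
  have hleft : ∑ a, σ a * (ν * ∑ i,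
      (G.agentCost T i (Function.update a i (o i)) - G.agentCost T i a)) =
      ν * ∑ i, ∑ a, σ a *
        (G.agentCost T i (Function.update a i (o i)) - G.agentCost T i a) := by
    rw [sum_comm, mul_sum]
    refine sum_congr rfl fun a _ => ?_
    rw [← mul_sum]
    ring
  have hright : ∑ a, σ a * (G.systemCost o - ρ * G.systemCost a) =
      G.systemCost o - ρ * G.expect σ G.systemCost := by
    simp only [mul_sub, sum_sub_distrib, ← sum_mul, hσ.1.2, one_mul, expect, mul_sum]
    exact congrArg _ (sum_congr rfl fun a _ => by ring)
  rw [hleft, hright] at hsmooth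
  have := mul_nonneg hν hdev
  linarith

end CongestionGame

lemma priceOfAnarchy_le_of_lpFeasible {n m : ℕ} {b τ : Fin m → ℕ → ℝ} {T : LocalMechanism}
    {ν ρ : ℝ} (hν : 0 ≤ ν) (hρ : 0 ≤ ρ)
    (hf : ∀ j, LPFeasible n (b j) (fun x => ν * (b j x + τ j x)) ρ)
    (hT : IsLinearMechanism n b τ T) (c : EquilibriumConcept) :
    priceOfAnarchy n b c T ≤ (ENNReal.ofReal ρ)⁻¹ := by
  rcases hρ.eq_or_lt with rfl | hpos
  · simp
  refine iSup₂_le fun G hG => ENNReal.div_le_of_le_mul ?_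
  refine (CongestionGame.worstCost_le_coarseCorrelated c).trans (iSup₂_le fun σ hσ => ?_)
  rw [CongestionGame.minCost, mul_comm, ← div_eq_mul_inv]
  rw [ENNReal.le_div_iff_mul_le (.inl (by simpa using hpos)) (.inl ENNReal.ofReal_ne_top)]
  refine le_iInf fun o => ?_
  rw [mul_comm, ← ENNReal.ofReal_mul hρ]
  exact ENNReal.ofReal_le_ofReal (hσ.mul_expect_systemCost_le hG hν hf hT o)

/-! ### Cyclic games and the lower bound -/

section CyclicGame

/-- Subtraction is modulo `n`, so `i ↦ e - i` is a permutation: loads do not depend on the position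
on the circle. -/
lemma card_fin_filter_sub_left {n : ℕ} [NeZero n] (e : Fin n) (P : ℕ → Prop) [DecidablePred P] :
    (univ.filter fun i : Fin n => P (e - i).val).card = ((range n).filter P).card := by
  rw [card_filter, card_filter, ← Fin.sum_univ_eq_sum_range (fun k => if P k then 1 else 0) n]
  exact (Equiv.subLeft e).sum_comp fun k : Fin n => if P k.val then 1 else 0

lemma sum_fin_sub_right {n : ℕ} [NeZero n] (i : Fin n) (P : ℕ → Prop) [DecidablePred P] (r : ℝ) :
    ∑ e : Fin n, (if P (e - i).val then r else 0) = ((range n).filter P).card * r := by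
  rw [card_filter, Nat.cast_sum, sum_mul,
    ← Fin.sum_univ_eq_sum_range (fun k => ((if P k then 1 else 0 : ℕ) : ℝ) * r) n]
  rw [← (Equiv.subRight i).sum_comp fun k : Fin n => ((if P k.val then 1 else 0 : ℕ) : ℝ) * r]
  exact sum_congr rfl fun e _ => by simp

lemma card_range_filter_lt {n x : ℕ} (h : x ≤ n) : ((range n).filter (· < x)).card = x := by
  rw [show (range n).filter (· < x) = range x by ext k; simp; omega, card_range]

lemma card_range_filter_le_lt {n u z : ℕ} (h : u + z ≤ n) :
    ((range n).filter fun k => u ≤ k ∧ k < u + z).card = z := by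
  rw [show ((range n).filter fun k => u ≤ k ∧ k < u + z) = Ico u (u + z) by ext k; simp; omega,
    Nat.card_Ico]
  omega

lemma card_range_filter_or {n x y z : ℕ} (h : x + y + z ≤ n) :
    ((range n).filter fun k => k < x ∨ (x + y ≤ k ∧ k < x + y + z)).card = x + z := by
  rw [filter_or, card_union_of_disjoint, card_range_filter_lt (by omega),
    card_range_filter_le_lt (by omega)]
  rw [disjoint_filter]
  intro k _ h1 h2
  omega

variable {κ : Type} [Fintype κ] [DecidableEq κ] (n : ℕ) [NeZero n] (t : κ → ℕ × ℕ × ℕ)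

/-- The first `x + y` resources on the circle, from `i` on, for each triple `(x, y, z)`. -/
def equilibriumAction (i : Fin n) : Finset (κ × Fin n) :=
  univ.filter fun e => (e.2 - i).val < (t e.1).1 + (t e.1).2.1

/-- The first `x` and the last `z` of the first `x + y + z` resources on the circle, from `i` on,
for each triple `(x, y, z)`. -/
def optimalAction (i : Fin n) : Finset (κ × Fin n) :=
  univ.filter fun e => (e.2 - i).val < (t e.1).1 ∨
    ((t e.1).1 + (t e.1).2.1 ≤ (e.2 - i).val ∧
      (e.2 - i).val < (t e.1).1 + (t e.1).2.1 + (t e.1).2.2)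

/-- The game with `n` agents, a circle of `n` resources of cost `ℓ` for each triple of the family
`t`, and two actions for each agent. -/
abbrev cyclicGame (ℓ : ℕ → ℝ) : CongestionGame where
  numAgents := n
  Resource := κ × Fin n
  actions i := {equilibriumAction n t i, optimalAction n t i}
  actions_nonempty _ := insert_nonempty _ _
  cost _ := ℓ

variable (ℓ : ℕ → ℝ)

def cyclicEquilibrium : (cyclicGame n t ℓ).Alloc :=
  fun i => ⟨equilibriumAction n t i, by simp⟩

def cyclicOptimum : (cyclicGame n t ℓ).Alloc :=
  fun i => ⟨optimalAction n t i, by simp⟩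

variable {n t} (ht : ∀ k, (t k).1 + (t k).2.1 + (t k).2.2 ≤ n)
include ht

lemma load_cyclicEquilibrium (e : κ × Fin n) :
    (cyclicGame n t ℓ).load (cyclicEquilibrium n t ℓ) e = (t e.1).1 + (t e.1).2.1 := by
  have h := card_fin_filter_sub_left e.2 (· < (t e.1).1 + (t e.1).2.1)
  rw [card_range_filter_lt (by have := ht e.1; omega)] at h
  rw [← h]
  simp [CongestionGame.load, cyclicEquilibrium, equilibriumAction]

lemma load_cyclicOptimum (e : κ × Fin n) :
    (cyclicGame n t ℓ).load (cyclicOptimum n t ℓ) e = (t e.1).1 + (t e.1).2.2 := by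
  have h := card_fin_filter_sub_left e.2 fun k => k < (t e.1).1 ∨
    ((t e.1).1 + (t e.1).2.1 ≤ k ∧ k < (t e.1).1 + (t e.1).2.1 + (t e.1).2.2)
  rw [card_range_filter_or (ht e.1)] at h
  rw [← h]
  simp [CongestionGame.load, cyclicOptimum, optimalAction]

lemma systemCost_cyclicEquilibrium :
    (cyclicGame n t ℓ).systemCost (cyclicEquilibrium n t ℓ) =
      n * ∑ k, ℓ ((t k).1 + (t k).2.1) * (((t k).1 + (t k).2.1 : ℕ) : ℝ) := by
  rw [CongestionGame.systemCost_eq]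
  simp_rw [load_cyclicEquilibrium ℓ ht]
  rw [Fintype.sum_prod_type, mul_sum]
  refine sum_congr rfl fun k _ => ?_
  dsimp only
  rw [sum_const, card_univ, Fintype.card_fin, nsmul_eq_mul, mul_comm (ℓ _)]

lemma systemCost_cyclicOptimum :
    (cyclicGame n t ℓ).systemCost (cyclicOptimum n t ℓ) =
      n * ∑ k, ℓ ((t k).1 + (t k).2.2) * (((t k).1 + (t k).2.2 : ℕ) : ℝ) := by
  rw [CongestionGame.systemCost_eq]
  simp_rw [load_cyclicOptimum ℓ ht]
  rw [Fintype.sum_prod_type, mul_sum]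
  refine sum_congr rfl fun k _ => ?_
  dsimp only
  rw [sum_const, card_univ, Fintype.card_fin, nsmul_eq_mul, mul_comm (ℓ _)]

lemma agentCost_cyclicEquilibrium (T : LocalMechanism) (i : Fin n) :
    (cyclicGame n t ℓ).agentCost T i (cyclicEquilibrium n t ℓ) =
      ∑ k, (((t k).1 + (t k).2.1 : ℕ) : ℝ) *
        (ℓ ((t k).1 + (t k).2.1) + T ℓ ((t k).1 + (t k).2.1)) := by
  simp only [CongestionGame.agentCost, load_cyclicEquilibrium ℓ ht]
  simp only [cyclicEquilibrium, equilibriumAction]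
  rw [sum_filter, Fintype.sum_prod_type]
  refine sum_congr rfl fun k _ => ?_
  dsimp only
  rw [sum_fin_sub_right i (· < (t k).1 + (t k).2.1),
    card_range_filter_lt (by have := ht k; omega)]

lemma agentCost_update_cyclicOptimum (T : LocalMechanism) (i : Fin n) :
    (cyclicGame n t ℓ).agentCost T i
        (Function.update (cyclicEquilibrium n t ℓ) i (cyclicOptimum n t ℓ i)) =
      ∑ k, (((t k).1 : ℝ) * (ℓ ((t k).1 + (t k).2.1) + T ℓ ((t k).1 + (t k).2.1)) +
        ((t k).2.2 : ℝ) * (ℓ ((t k).1 + (t k).2.1 + 1) + T ℓ ((t k).1 + (t k).2.1 + 1))) := by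
  have hload : ∀ e ∈ (cyclicOptimum n t ℓ i).1, (cyclicGame n t ℓ).load
      (Function.update (cyclicEquilibrium n t ℓ) i (cyclicOptimum n t ℓ i)) e =
      if (e.2 - i).val < (t e.1).1 + (t e.1).2.1 then (t e.1).1 + (t e.1).2.1
        else (t e.1).1 + (t e.1).2.1 + 1 := by
    intro e he
    rw [CongestionGame.load_update _ he, load_cyclicEquilibrium ℓ ht]
    simp [cyclicEquilibrium, equilibriumAction]
  rw [CongestionGame.agentCost, Function.update_self,
    sum_congr rfl fun e he => by rw [hload e he]]
  simp only [cyclicOptimum, optimalAction]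
  rw [sum_filter, Fintype.sum_prod_type]
  refine sum_congr rfl fun k _ => ?_
  have h1 := sum_fin_sub_right i (· < (t k).1)
    (ℓ ((t k).1 + (t k).2.1) + T ℓ ((t k).1 + (t k).2.1))
  have h2 := sum_fin_sub_right i
    (fun d => (t k).1 + (t k).2.1 ≤ d ∧ d < (t k).1 + (t k).2.1 + (t k).2.2)
    (ℓ ((t k).1 + (t k).2.1 + 1) + T ℓ ((t k).1 + (t k).2.1 + 1))
  rw [card_range_filter_lt (by have := ht k; omega)] at h1
  rw [card_range_filter_le_lt (ht k)] at h2
  rw [← h1, ← h2, ← sum_add_distrib]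
  refine sum_congr rfl fun e _ => ?_
  dsimp only
  generalize (e - i).val = d
  split_ifs <;> first | omega | simp

/-- By rotation all agents face the same comparison: for each triple, deviating gives up `y`
resources of load `x + y` and joins `z` whose load becomes `x + y + 1`. The hypothesis says that
this does not pay. -/
lemma isPureNash_cyclicEquilibrium (T : LocalMechanism)
    (h : ∑ k, ((ℓ ((t k).1 + (t k).2.1) + T ℓ ((t k).1 + (t k).2.1)) * ((t k).2.1 : ℝ) -
      (ℓ ((t k).1 + (t k).2.1 + 1) + T ℓ ((t k).1 + (t k).2.1 + 1)) * ((t k).2.2 : ℝ)) ≤ 0) :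
    (cyclicGame n t ℓ).IsPureNash T (cyclicEquilibrium n t ℓ) := by
  intro i ⟨s, hs⟩
  have hs' : s = equilibriumAction n t i ∨ s = optimalAction n t i := by simpa using hs
  rcases hs' with rfl | rfl
  · exact (congrArg _ (Function.update_eq_self i (cyclicEquilibrium n t ℓ)).symm).le
  · refine le_of_le_of_eq ?_ (agentCost_update_cyclicOptimum ℓ ht T i).symm
    rw [agentCost_cyclicEquilibrium ℓ ht, ← sub_nonpos, ← sum_sub_distrib]
    refine (sum_congr rfl fun k _ => ?_).trans_le h
    push_cast
    ring

end CyclicGame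

lemma inv_le_priceOfAnarchy_of_forall_not_lpFeasible {n m : ℕ} {b : Fin m → ℕ → ℝ} {j : Fin m}
    (hb : ∀ x ∈ Icc 1 n, 0 ≤ b j x) {ρ : ℝ} (hρ : 0 < ρ)
    (h : ∀ f, ¬ LPFeasible n (b j) f ρ) (T : LocalMechanism) (c : EquilibriumConcept) :
    (ENNReal.ofReal ρ)⁻¹ ≤ priceOfAnarchy n b c T := by
  classical
  set F : ℕ → ℝ := fun x => b j x + T (b j) x with hF
  set A : ℕ × ℕ × ℕ → ℝ := fun t => b j (t.1 + t.2.2) * ((t.1 + t.2.2 : ℕ) : ℝ)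
    - ρ * (b j (t.1 + t.2.1) * ((t.1 + t.2.1 : ℕ) : ℝ)) with hA
  set C : ℕ × ℕ × ℕ → ℝ := fun t => F (t.1 + t.2.1) * (t.2.1 : ℝ)
    - F (t.1 + t.2.1 + 1) * (t.2.2 : ℝ) with hC
  set S : Finset (ℕ × ℕ × ℕ) :=
    (range (n + 1) ×ˢ range (n + 1) ×ˢ range (n + 1)).filter
      fun t => 1 ≤ t.1 + t.2.1 + t.2.2 ∧ t.1 + t.2.1 + t.2.2 ≤ n with hS
  obtain ⟨s, hs, t, ht, p, q, hCle, hAlt⟩ := exists_nat_combination S A C (by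
    intro ν _
    have := h fun x => ν * F x
    unfold LPFeasible at this
    push Not at this
    obtain ⟨x, y, z, ⟨h1, h2, -⟩, hlt⟩ := this
    dsimp only at h1 h2
    refine ⟨(x, y, z), ?_, ?_⟩
    · simp only [hS, mem_filter, mem_product, mem_range]
      omega
    · simp only [hA, hC]
      linarith)
  have hs' := (mem_filter.1 hs).2
  have ht' := (mem_filter.1 ht).2
  have : NeZero n := ⟨by omega⟩
  -- The Farkas multipliers become numbers of circles: `p` for `s` and `q` for `t`. Then `C` encodes
  -- the equilibrium condition and `A` the cost comparison.
  let u : Fin p ⊕ Fin q → ℕ × ℕ × ℕ := Sum.elim (fun _ => s) fun _ => t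
  have hu : ∀ k, (u k).1 + (u k).2.1 + (u k).2.2 ≤ n := by
    rintro (k | k)
    exacts [hs'.2, ht'.2]
  have husum : ∀ g : ℕ × ℕ × ℕ → ℝ, ∑ k, g (u k) = p * g s + q * g t := by
    intro g
    simp [u, Fintype.sum_sum_type]
  let G := cyclicGame n u (b j)
  have hG : G ∈ gameClass n b := by
    refine ⟨le_rfl, fun _ => ⟨Pi.single j 1, fun k => ?_, fun x => ?_⟩⟩
    · by_cases hk : k = j
      · subst hk; simp
      · simp [Pi.single_eq_of_ne hk]
    · simp [G, Pi.single_apply]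
  have hNash : G.IsPureNash T (cyclicEquilibrium n u (b j)) := by
    refine isPureNash_cyclicEquilibrium (b j) hu T ?_
    exact (husum C).trans_le hCle
  have hlt : G.systemCost (cyclicOptimum n u (b j)) <
      ρ * G.systemCost (cyclicEquilibrium n u (b j)) := by
    rw [systemCost_cyclicEquilibrium _ hu, systemCost_cyclicOptimum _ hu, mul_left_comm]
    have hn : (0 : ℝ) < n := by exact_mod_cast Nat.pos_of_ne_zero (NeZero.ne n)
    refine mul_lt_mul_of_pos_left ?_ hn
    rw [mul_sum, ← sub_neg, ← sum_sub_distrib]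
    exact (husum A).trans_lt hAlt
  have hopt : 0 ≤ G.systemCost (cyclicOptimum n u (b j)) := by
    rw [systemCost_cyclicOptimum _ hu]
    refine mul_nonneg n.cast_nonneg (sum_nonneg fun k _ => ?_)
    rcases Nat.eq_zero_or_pos ((u k).1 + (u k).2.2) with h0 | h0
    · simp [h0]
    · exact mul_nonneg (hb _ (mem_Icc.2 ⟨h0, by have := hu k; omega⟩)) (Nat.cast_nonneg _)
  have hpos : 0 < G.systemCost (cyclicEquilibrium n u (b j)) :=
    pos_of_mul_pos_right (hopt.trans_lt hlt) hρ.le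
  calc (ENNReal.ofReal ρ)⁻¹
      ≤ ENNReal.ofReal (G.systemCost (cyclicEquilibrium n u (b j))) /
          ENNReal.ofReal (G.systemCost (cyclicOptimum n u (b j))) := by
        -- The cost of `cyclicOptimum` may vanish; positivity of the equilibrium cost then makes the
        -- ratio `∞`.
        rw [ENNReal.le_div_iff_mul_le (.inr (by simpa using hpos)) (.inl ENNReal.ofReal_ne_top),
          mul_comm, ← div_eq_mul_inv]
        refine ENNReal.div_le_of_le_mul ?_
        rw [mul_comm, ← ENNReal.ofReal_mul hρ.le]
        exact ENNReal.ofReal_le_ofReal hlt.le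
    _ ≤ G.worstCost T c / G.minCost :=
        ENNReal.div_le_div (hNash.le_worstCost c) (iInf_le _ _)
    _ ≤ priceOfAnarchy n b c T :=
        le_iSup₂ (f := fun (G : CongestionGame) (_ : G ∈ gameClass n b) =>
          G.worstCost T c / G.minCost) G hG

/-- Every `r > ρ` is infeasible and gives the bound `1 / r`; letting `r` decrease to `ρ` also covers
`ρ = 0`. -/
lemma IsLPSolution.inv_le_priceOfAnarchy {n m : ℕ} {b : Fin m → ℕ → ℝ} {j : Fin m}
    (hb : ∀ x ∈ Icc 1 n, 0 ≤ b j x) {f : ℕ → ℝ} {ρ : ℝ} (h : IsLPSolution n (b j) f ρ)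
    (T : LocalMechanism) (c : EquilibriumConcept) :
    (ENNReal.ofReal ρ)⁻¹ ≤ priceOfAnarchy n b c T := by
  have hρ := h.nonneg hb
  rw [ENNReal.inv_le_iff_inv_le]
  refine le_of_forall_gt_imp_ge_of_dense fun r hr => ?_
  rcases eq_or_ne r ⊤ with rfl | hr'
  · exact le_top
  lift r to NNReal using hr'
  rw [ENNReal.inv_le_iff_inv_le, ← ENNReal.ofReal_coe_nnreal]
  have hlt : ρ < r := by
    rw [← ENNReal.ofReal_coe_nnreal] at hr
    exact (ENNReal.ofReal_lt_ofReal_iff_of_nonneg hρ).1 hr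
  exact inv_le_priceOfAnarchy_of_forall_not_lpFeasible hb (hρ.trans_lt hlt)
    (fun f' hf' => (h.2 f' _ hf').not_gt hlt) T c

lemma exists_isLinearMechanism (n : ℕ) {m : ℕ} (b τ : Fin m → ℕ → ℝ) :
    ∃ T, IsLinearMechanism n b τ T := by
  classical
  refine ⟨fun ℓ x => if h : ℓ ∈ costClass b then ∑ j, h.choose j * τ j x else 0, fun ℓ hℓ => ?_⟩
  exact ⟨hℓ.choose, hℓ.choose_spec, fun x _ => dif_pos hℓ⟩

theorem theorem1 (n m : ℕ) (hm : 0 < m) (b : Fin m → ℕ → ℝ)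
    (hb_nonneg : ∀ j, ∀ x ∈ Finset.Icc 1 n, 0 ≤ b j x)
    (hb_ne_zero : ∀ j, ∃ x ∈ Finset.Icc 1 n, b j x ≠ 0) :
    -- every one of the linear programs has a solution
    (∀ j, ∃ (f : ℕ → ℝ) (ρ : ℝ), IsLPSolution n (b j) f ρ) ∧
    ∀ (f : Fin m → ℕ → ℝ) (ρ : Fin m → ℝ), (∀ j, IsLPSolution n (b j) (f j) (ρ j)) →
      -- the linear mechanism with `τ_j = f_j - b_j` is optimal, with the stated price of anarchy
      ((∃ T, IsLinearMechanism n b (fun j x => f j x - b j x) T) ∧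
        ∀ T, IsLinearMechanism n b (fun j x => f j x - b j x) T →
          ∀ c : EquilibriumConcept,
            priceOfAnarchy n b c T = (⨆ j, (ENNReal.ofReal (ρ j))⁻¹) ∧
            ∀ T' : LocalMechanism, priceOfAnarchy n b c T ≤ priceOfAnarchy n b c T') ∧
      -- the rescaled linear mechanism has nonnegative tolls and is optimal as well
      ((⨆ j, (ENNReal.ofReal (ρ j))⁻¹) ≠ ⊤ →
        (∃ T, IsLinearMechanism n b
          (fun j x => f j x * (⨆ j, (ENNReal.ofReal (ρ j))⁻¹).toReal - b j x) T) ∧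
        ∀ T, IsLinearMechanism n b
            (fun j x => f j x * (⨆ j, (ENNReal.ofReal (ρ j))⁻¹).toReal - b j x) T →
          (∀ ℓ ∈ costClass b, ∀ x ∈ Finset.Icc 1 n, 0 ≤ T ℓ x) ∧
          ∀ c : EquilibriumConcept,
            priceOfAnarchy n b c T = (⨆ j, (ENNReal.ofReal (ρ j))⁻¹) ∧
            ∀ T' : LocalMechanism, priceOfAnarchy n b c T ≤ priceOfAnarchy n b c T') := by
  have hsol := fun j => exists_isLPSolution (hb_nonneg j) (hb_ne_zero j)
  refine ⟨hsol, fun f ρ hfρ => ?_⟩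
  have : Nonempty (Fin m) := ⟨⟨0, hm⟩⟩
  obtain ⟨j₀, hj₀⟩ := Finite.exists_min ρ
  have hρ₀ : 0 ≤ ρ j₀ := (hfρ j₀).nonneg (hb_nonneg j₀)
  have hsup : (⨆ j, (ENNReal.ofReal (ρ j))⁻¹) = (ENNReal.ofReal (ρ j₀))⁻¹ :=
    le_antisymm (iSup_le fun j => ENNReal.inv_le_inv.2 (ENNReal.ofReal_le_ofReal (hj₀ j)))
      (le_iSup (fun j => (ENNReal.ofReal (ρ j))⁻¹) j₀)
  have hfeas : ∀ j, LPFeasible n (b j) (f j) (ρ j₀) := fun j =>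
    (hfρ j).1.mono (hb_nonneg j) (hj₀ j)
  have hlower : ∀ T c, (ENNReal.ofReal (ρ j₀))⁻¹ ≤ priceOfAnarchy n b c T := fun T c =>
    (hfρ j₀).inv_le_priceOfAnarchy (hb_nonneg j₀) T c
  rw [hsup]
  -- Both mechanisms are instances: `ν = 1` for the first and `ν = ρ j₀` for the rescaled one.
  have hopt : ∀ (τ : Fin m → ℕ → ℝ) (ν : ℝ), 0 ≤ ν →
      (∀ j x, ν * (b j x + τ j x) = f j x) → ∀ T, IsLinearMechanism n b τ T →
      ∀ c, priceOfAnarchy n b c T = (ENNReal.ofReal (ρ j₀))⁻¹ ∧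
        ∀ T', priceOfAnarchy n b c T ≤ priceOfAnarchy n b c T' := by
    intro τ ν hν hτ T hT c
    have hle : priceOfAnarchy n b c T ≤ (ENNReal.ofReal (ρ j₀))⁻¹ :=
      priceOfAnarchy_le_of_lpFeasible hν hρ₀ (fun j => by simpa only [hτ] using hfeas j) hT c
    exact ⟨hle.antisymm (hlower T c), fun T' => hle.trans (hlower T' c)⟩
  refine ⟨⟨exists_isLinearMechanism n b _, hopt _ 1 zero_le_one fun j x => by ring⟩,
    fun hfin => ⟨exists_isLinearMechanism n b _, fun T hT => ?_⟩⟩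
  have hpos : 0 < ρ j₀ := by simpa using hfin
  have hK : (ENNReal.ofReal (ρ j₀))⁻¹.toReal = (ρ j₀)⁻¹ := by
    rw [ENNReal.toReal_inv, ENNReal.toReal_ofReal hρ₀]
  rw [hK] at hT
  refine ⟨fun ℓ hℓ x hx => ?_, hopt _ (ρ j₀) hρ₀ (fun j x => ?_) T hT⟩
  · obtain ⟨α, ⟨hα, -⟩, hTα⟩ := hT ℓ hℓ
    rw [hTα x hx]
    -- Nonnegativity amounts to `ρ j₀ * b j x ≤ f j x`, as `f j` is feasible with the smaller value
    -- `ρ j₀`.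
    refine Finset.sum_nonneg fun j _ => mul_nonneg (hα j) (sub_nonneg.2 ?_)
    rw [← div_eq_mul_inv, le_div_iff₀ hpos, mul_comm]
    exact (hfeas j).mul_le hx
  · rw [add_sub_cancel, mul_left_comm, mul_inv_cancel₀ hpos.ne', mul_one]
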